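/- **Definitions.** An *EMV-algebra* is an algebra $(M;\vee,\wedge,\oplus,0)$ such that $(M;\vee,\wedge)$ is a distributive lattice with bottom element $0$; $(M;\oplus,0)$ is a commutative ordered monoid (that is, $x\le y$ implies $x\oplus z\le y\oplus z$); for each idempotent $a$ (that is, $a\oplus a=a$) and each $x\in[0,a]$ the element $\lambda_a(x)=\min\{z\in[0,a]: z\oplus x=a\}$ exists, and $([0,a];\oplus,\lambda_a,0,a)$ is an MV-algebra; and every $x\in M$ lies below some idempotent. Let $\mathcal I(M)$ be the set of idempotents. For $x,y\in M$ put $x\odot y=\lambda_a(\lambda_a(x)\oplus\lambda_a(y))$, where $a$ is any idempotent with $x,y\le a$ (the result does not depend on $a$). Put $0.x=0$, $(n+1).x=n.x\oplus x$, and $x^1=x$, $x^{n+1}=x^n\odot x$ for $n\ge 1$. The algebra $M$ is *$\sigma$-complete* if every countable family of elements of $M$ has a least upper bound in $M$. The interval $[0,1]$ is an EMV-algebra with its usual order and $s\oplus t=\min\{1,s+t\}$. A *state-morphism* on $M$ is a map $s:M\to[0,1]$ that preserves $\vee,\wedge,\oplus,0$, satisfies $s(\lambda_b(x))=\lambda_{s(b)}(s(x))$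 for all $b\in\mathcal I(M)$ and $x\in[0,b]$, and takes the value $1$ at some element of $M$. The set $\mathcal{SM}(M)$ of state-morphisms carries the weak topology, i.e. the topology of pointwise convergence (the subspace topology from $[0,1]^M$). For $x\in M$ let $S(x)=\{s\in\mathcal{SM}(M): s(x)>0\}$, and let $\overline{S(x)}$ be its closure in $\mathcal{SM}(M)$. **Theorem.** Let $M$ be a $\sigma$-complete EMV-algebra. (a) For each $x\in M$, the element $a_0(x):=\bigvee_n n.x$ exists in $M$, is an idempotent with $a_0(x)\ge x$, and $a_0(x)=\bigwedge\{a\in\mathcal I(M): a\ge x\}$. In addition, $\overline{S(x)}=S(a_0(x))$, and if $\overline{S(x)}=S(b)$ for some $b\in\mathcal I(M)$, then $a_0(x)=b$. (b) For each $x\in M$, the element $b_0(x):=\bigwedge_{n\ge 1}x^n$ exists in $M$, is an idempotent with $b_0(x)\le x$, and $b_0(x)=\bigvee\{b\in\mathcal I(M): b\le x\}$. (c) If $x\le y$ in $M$ and $b$ is an idempotent with $\overline{S(y)}=S(b)$, then $a_0(x)\le b$. (d) Let $x,x_1,x_2,\ldots\in M$ and $a,a_1,a_2,\ldots\in\mathcal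 I(M)$ satisfy $\overline{S(x)}=S(a)$ and $\overline{S(x_n)}=S(a_n)$ for each $n\ge1$. If $x=\bigvee_n x_n$, then $a=\bigvee_n a_n$. In particular, $x=\bigvee_n x_n$ implies $a_0(x)=\bigvee_n a_0(x_n)$. -/

import Mathlib

namespace EMV

/-- The subset `A`, with the operations `op`, `star` and the constants `zero`, `one`,
is an MV-algebra `(A; op, star, zero, one)`. -/
structure IsMVAlgebraOn {M : Type*} (A : Set M) (op : M → M → M) (star : M → M)
    (zero one : M) : Prop where
  zero_mem : zero ∈ A
  one_mem : one ∈ A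
  op_mem : ∀ x ∈ A, ∀ y ∈ A, op x y ∈ A
  star_mem : ∀ x ∈ A, star x ∈ A
  op_assoc : ∀ x ∈ A, ∀ y ∈ A, ∀ z ∈ A, op (op x y) z = op x (op y z)
  op_comm : ∀ x ∈ A, ∀ y ∈ A, op x y = op y x
  op_zero : ∀ x ∈ A, op x zero = x
  star_star : ∀ x ∈ A, star (star x) = x
  op_one : ∀ x ∈ A, op x one = one
  op_star : ∀ x ∈ A, ∀ y ∈ A,
    op x (star (op x (star y))) = op y (star (op y (star x)))

/-- Idempotents of `(M; +)`. -/
def IsIdem {M : Type*} [Add M] (a : M) : Prop := a + a = a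

open Classical in
/-- `lam a x = min {z ∈ [0, a] | z + x = a}`; the value is `a` if there is no such minimum. -/
noncomputable def lam {M : Type*} [PartialOrder M] [AddZeroClass M] (a x : M) : M :=
  if h : ∃ z, IsLeast {z : M | z ∈ Set.Icc 0 a ∧ z + x = a} z then h.choose else a

theorem lam_eq {M : Type*} [PartialOrder M] [AddZeroClass M] {a x z : M}
    (hz : IsLeast {z : M | z ∈ Set.Icc 0 a ∧ z + x = a} z) : lam a x = z := by
  have h : ∃ z, IsLeast {z : M | z ∈ Set.Icc 0 a ∧ z + x = a} z := ⟨z, hz⟩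
  rw [lam, dif_pos h]
  exact h.choose_spec.unique hz

end EMV

/-- An EMV-algebra `(M; ⊔, ⊓, +, 0)`; the operation `⊕` is written `+`, so that `n • x` is the
`n`-fold sum `n.x`. -/
class EMVAlgebra (M : Type*) extends DistribLattice M, AddCommMonoid M where
  /-- `0` is the bottom element of the lattice. -/
  zero_le' : ∀ x : M, 0 ≤ x
  /-- `(M; +, 0)` is an ordered monoid. -/
  add_le_add' : ∀ x y z : M, x ≤ y → x + z ≤ y + z
  /-- The minimum that defines `λ_a x` exists. -/
  lam_isLeast : ∀ a x : M, EMV.IsIdem a → x ∈ Set.Icc 0 a →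
    IsLeast {z : M | z ∈ Set.Icc 0 a ∧ z + x = a} (EMV.lam a x)
  /-- `([0, a]; +, λ_a, 0, a)` is an MV-algebra. -/
  isMV : ∀ a : M, EMV.IsIdem a →
    EMV.IsMVAlgebraOn (Set.Icc (0 : M) a) (fun x y => x + y) (EMV.lam a) 0 a
  /-- Every element lies below an idempotent. -/
  exists_idem : ∀ x : M, ∃ a : M, EMV.IsIdem a ∧ x ≤ a

namespace EMV

/-- `x ⊙ y = λ_a (λ_a x ⊕ λ_a y)`, where `a` is an idempotent above `x` and `y`. -/
noncomputable def odot {M : Type*} [EMVAlgebra M] (x y : M) : M :=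
  let a := (EMVAlgebra.exists_idem (x ⊔ y)).choose
  lam a (lam a x + lam a y)

/-- `powSucc x n` is the power `x ^ (n + 1)` with respect to `⊙`, that is
`x ^ 1 = x` and `x ^ (n + 1) = x ^ n ⊙ x` for `n ≥ 1`. -/
noncomputable def powSucc {M : Type*} [EMVAlgebra M] (x : M) : ℕ → M
  | 0 => x
  | n + 1 => odot (powSucc x n) x

/-- Every countable family has a least upper bound. -/
def IsSigmaComplete (M : Type*) [EMVAlgebra M] : Prop :=
  ∀ f : ℕ → M, ∃ s : M, IsLUB (Set.range f) s

/-- `x ⊕ y = min (1, x + y)` on the real unit interval. -/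
noncomputable def unitAdd (x y : unitInterval) : unitInterval :=
  ⟨min 1 ((x : ℝ) + y), le_min zero_le_one (add_nonneg x.2.1 y.2.1), min_le_left _ _⟩

theorem unit_lam {a x : unitInterval} (hx : x ≤ a) :
    ∃ z : unitInterval, (z : ℝ) = a - x ∧ z ≤ a ∧ unitAdd z x = a ∧
      ∀ w : unitInterval, unitAdd w x = a → z ≤ w := by
  have hx' : (x : ℝ) ≤ a := hx
  refine ⟨⟨(a : ℝ) - x, by linarith, by linarith [a.2.2, x.2.1]⟩, rfl, ?_, ?_, ?_⟩
  · exact Subtype.coe_le_coe.mp (by simpa using x.2.1)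
  · apply Subtype.ext
    simpa [unitAdd] using a.2.2
  · intro w hw
    have h : min 1 ((w : ℝ) + x) = a := congrArg Subtype.val hw
    have := min_le_right 1 ((w : ℝ) + x)
    exact Subtype.coe_le_coe.mp (by simp only; linarith)

theorem unit_idem {a : unitInterval} (ha : unitAdd a a = a) : (a : ℝ) = 0 ∨ (a : ℝ) = 1 := by
  have h : min 1 ((a : ℝ) + a) = a := congrArg Subtype.val ha
  rcases min_choice 1 ((a : ℝ) + a) with h' | h' <;> rw [h'] at h
  · exact Or.inr h.symm
  · left; linarith

theorem unitAdd_assoc (x y z : unitInterval) :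
    unitAdd (unitAdd x y) z = unitAdd x (unitAdd y z) := by
  apply Subtype.ext
  have := x.2.1
  have := z.2.1
  simp only [unitAdd]
  grind

theorem unitAdd_comm (x y : unitInterval) : unitAdd x y = unitAdd y x := by
  apply Subtype.ext
  simp only [unitAdd, add_comm]

theorem unitAdd_zero (x : unitInterval) : unitAdd x 0 = x := by
  apply Subtype.ext
  simpa [unitAdd] using x.2.2

noncomputable instance unitHasAdd : Add unitInterval := ⟨unitAdd⟩

noncomputable instance unitAddCommMonoid : AddCommMonoid unitInterval where
  add_assoc := unitAdd_assoc
  zero_add x := (unitAdd_comm 0 x).trans (unitAdd_zero x)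
  add_zero := unitAdd_zero
  add_comm := unitAdd_comm
  nsmul := @nsmulRec unitInterval _ ⟨unitAdd⟩

theorem unit_isLeast {a x : unitInterval} (hx : x ≤ a) :
    IsLeast {z : unitInterval | z ∈ Set.Icc 0 a ∧ z + x = a} (lam a x) ∧
      ((lam a x : unitInterval) : ℝ) = a - x := by
  obtain ⟨z, h1, h2, h3, h4⟩ := unit_lam hx
  have hz : IsLeast {z : unitInterval | z ∈ Set.Icc 0 a ∧ z + x = a} z :=
    ⟨⟨⟨z.2.1, h2⟩, h3⟩, fun w hw => h4 w hw.2⟩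
  rw [lam_eq hz]
  exact ⟨hz, h1⟩

theorem unit_coe_add (x y : unitInterval) : ((x + y : unitInterval) : ℝ) = min 1 ((x : ℝ) + y) :=
  rfl

theorem unit_isMV {a : unitInterval} (ha : IsIdem a) :
    IsMVAlgebraOn (Set.Icc (0 : unitInterval) a) (fun x y => x + y) (lam a) 0 a := by
  have hadd : ∀ x ∈ Set.Icc (0 : unitInterval) a, ∀ y ∈ Set.Icc (0 : unitInterval) a,
      x + y ∈ Set.Icc (0 : unitInterval) a := by
    intro x hx y hy
    have hx' : (x : ℝ) ≤ a := hx.2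
    have hy' : (y : ℝ) ≤ a := hy.2
    have h : min 1 ((a : ℝ) + a) = a := congrArg Subtype.val ha
    refine ⟨(x + y).2.1, ?_⟩
    apply Subtype.coe_le_coe.mp
    rw [unit_coe_add, ← h]
    exact min_le_min le_rfl (by linarith)
  have hlam : ∀ x ∈ Set.Icc (0 : unitInterval) a, lam a x ∈ Set.Icc (0 : unitInterval) a :=
    fun x hx => (unit_isLeast hx.2).1.1.1
  refine ⟨⟨le_rfl, a.2.1⟩, ⟨a.2.1, le_rfl⟩, hadd, hlam, fun x _ y _ z _ => add_assoc x y z,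
    fun x _ y _ => add_comm x y, fun x _ => add_zero x, ?_, ?_, ?_⟩
  · intro x hx
    apply Subtype.ext
    rw [(unit_isLeast (hlam x hx).2).2, (unit_isLeast hx.2).2]
    ring
  · intro x hx
    apply Subtype.ext
    have hx' : (x : ℝ) ≤ a := hx.2
    have h0 : (0 : ℝ) ≤ x := x.2.1
    show min 1 ((x : ℝ) + a) = a
    rcases unit_idem ha with h | h
    · rw [h] at hx' ⊢
      rw [le_antisymm hx' h0]; simp
    · rw [h]
      exact min_eq_left (by linarith)
  · intro x hx y hy
    apply Subtype.ext
    have hx' : (x : ℝ) ≤ a := hx.2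
    have hy' : (y : ℝ) ≤ a := hy.2
    have h0 : (0 : ℝ) ≤ x := x.2.1
    have h1 : (0 : ℝ) ≤ y := y.2.1
    have e1 := (unit_isLeast (hadd x hx _ (hlam y hy)).2).2
    have e2 := (unit_isLeast (hadd y hy _ (hlam x hx)).2).2
    simp only [unit_coe_add] at e1 e2 ⊢
    rw [e1, e2, (unit_isLeast hx.2).2, (unit_isLeast hy.2).2]
    rcases unit_idem ha with h | h <;> rw [h] at hx' hy' ⊢ <;> grind

/-- The EMV-algebra of the real unit interval. -/
noncomputable instance unitEMVAlgebra : EMVAlgebra unitInterval where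
  __ := (inferInstance : DistribLattice unitInterval)
  __ := unitAddCommMonoid
  zero_le' x := x.2.1
  add_le_add' x y z h := by
    have h' : (x : ℝ) ≤ y := h
    apply Subtype.coe_le_coe.mp
    exact min_le_min le_rfl (by linarith)
  lam_isLeast _ _ _ hx := (unit_isLeast hx.2).1
  isMV _ ha := unit_isMV ha
  exists_idem x := ⟨1, Subtype.ext (by show min 1 ((1 : ℝ) + 1) = 1; norm_num), x.2.2⟩

end EMV

/-- EMV-homomorphisms. -/
structure EMVHom (M N : Type*) [EMVAlgebra M] [EMVAlgebra N] where
  toFun : M → N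
  map_sup : ∀ x y, toFun (x ⊔ y) = toFun x ⊔ toFun y
  map_inf : ∀ x y, toFun (x ⊓ y) = toFun x ⊓ toFun y
  map_add : ∀ x y, toFun (x + y) = toFun x + toFun y
  map_zero : toFun 0 = 0
  map_lam : ∀ b, EMV.IsIdem b → ∀ x, x ∈ Set.Icc 0 b →
    toFun (EMV.lam b x) = EMV.lam (toFun b) (toFun x)

/-- State-morphisms: EMV-homomorphisms into `[0, 1]` that attain the value `1`. -/
structure StateMorphism (M : Type*) [EMVAlgebra M] extends EMVHom M unitInterval where
  exists_eq_one : ∃ x, toFun x = 1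

namespace EMV

/-- The weak topology: the topology of pointwise convergence, induced from `[0, 1] ^ M`. -/
instance weakTopology {M : Type*} [EMVAlgebra M] : TopologicalSpace (StateMorphism M) :=
  TopologicalSpace.induced (fun s : StateMorphism M => (s.toFun : M → unitInterval)) inferInstance

/-- `S(x)`, the set of state-morphisms `s` with `s(x) > 0`. -/
def stateSupport {M : Type*} [EMVAlgebra M] (x : M) : Set (StateMorphism M) :=
  {s | 0 < s.toFun x}

end EMV

set_option linter.unusedSectionVars false

/-! Inside an interval `[0, a]` with `a` idempotent the MV-difference `λ_a (λ_a x ⊕ y)` satisfies `x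
⊖ y ≤ z ↔ x ≤ z ⊕ y`, so it does not depend on `a`, and all of `M` becomes a residuated ordered
monoid. From residuation, `⊓` and `⊕` distribute over existing suprema. Hence the supremum of the
multiples of `x` is idempotent: it is the least idempotent above `x`, its hull. The kernel `b₀ x` is
the dual `a ⊖ hull (a ⊖ x)`. The supremum of countably many idempotents is idempotent because `u ⊕ v
≤ u ⊔ v` for idempotents, so hulls commute with countable suprema.

The topological claims rest on three facts. Disjoint elements have disjoint hulls
(`idemHull_inf_eq_zero`). The sets `S(z)` form a base of the weak topology
(`exists_stateSupport_subset`). Every nonzero element is positive under some state-morphism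
(`exists_stateMorphism_pos`). If `s` lies in `S(hull x)` but not in the closure of `S(x)`, some
`S(z)` contains `s` and misses `S(x)`; then `z ⊓ x = 0`, so `z ⊓ hull x = 0`, which contradicts the
positivity of `s` on both.

State-morphisms come from chains. A prime lattice ideal, pulled back along the hull, gives an ideal
with totally ordered quotient. A nontrivial chain with top `e` maps to `[0, 1]` by measuring `x`
through limits of `⌊n x / e⌋ / n`. -/

namespace EMV

/-- Residuated monoids in which double relative complements are trivial. -/
class IsInvolutiveSub (α : Type*) [LE α] [Sub α] : Prop where
  sub_sub_of_le : ∀ x y : α, y ≤ x → x - (x - y) = y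

theorem sub_sub_of_le {α : Type*} [LE α] [Sub α] [IsInvolutiveSub α] {x y : α} (h : y ≤ x) :
    x - (x - y) = y :=
  IsInvolutiveSub.sub_sub_of_le x y h

/-! ### Truncated subtraction with involutive complements -/

section InvolutiveSub

variable {α : Type*} [AddCommMonoid α] [PartialOrder α] [IsOrderedAddMonoid α]
  [CanonicallyOrderedAdd α] [Sub α] [OrderedSub α] [IsInvolutiveSub α]


theorem sub_eq_compl_sub {x w : α} (s : α) (hw : w ≤ x) : w - s = (x - s) - (x - w) := by
  conv_lhs => rw [← sub_sub_of_le hw]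
  rw [tsub_right_comm]

theorem add_le_of_le_sub {x r s : α} (hs : s ≤ x) (hr : r ≤ x - s) : r + s ≤ x :=
  (add_le_add_left hr s).trans (tsub_add_cancel_of_le hs).le

/-- Cancellation survives as long as the sum does not overflow `x`: complementing in `x` turns the
left side into `(x - s) - ((x - s) - r)`. Most later identities reduce to this. -/
theorem add_sub_cancel_of_le_sub {x r s : α} (hs : s ≤ x) (hr : r ≤ x - s) :
    (r + s) - s = r := by
  rw [sub_eq_compl_sub s (add_le_of_le_sub hs hr), add_comm r s, tsub_add_eq_tsub_tsub,
    sub_sub_of_le hr]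

theorem le_sub_comm_of_le {x r s : α} (hs : s ≤ x) (hr : r ≤ x - s) : s ≤ x - r := by
  rw [← sub_sub_of_le hs]
  exact tsub_le_tsub_left hr x

end InvolutiveSub

/-! ### Residuation and idempotents in an EMV-algebra -/

section Basic

variable {M : Type*} [EMVAlgebra M]

theorem zero_le_of (x : M) : 0 ≤ x := EMVAlgebra.zero_le' x

instance isOrderedAddMonoid : IsOrderedAddMonoid M where
  add_le_add_left x y h z := EMVAlgebra.add_le_add' x y z h

theorem exists_idem_ge (x y : M) : ∃ a : M, IsIdem a ∧ x ≤ a ∧ y ≤ a := by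
  obtain ⟨a, ha, h⟩ := EMVAlgebra.exists_idem (x ⊔ y)
  exact ⟨a, ha, le_sup_left.trans h, le_sup_right.trans h⟩

theorem exists_idem_ge₃ (x y z : M) : ∃ a : M, IsIdem a ∧ x ≤ a ∧ y ≤ a ∧ z ≤ a := by
  obtain ⟨a, ha, h, hz⟩ := exists_idem_ge (x ⊔ y) z
  exact ⟨a, ha, le_sup_left.trans h, le_sup_right.trans h, hz⟩

theorem IsIdem.add_le {a x y : M} (ha : IsIdem a) (hx : x ≤ a) (hy : y ≤ a) : x + y ≤ a :=
  (add_le_add hx hy).trans (le_of_eq ha)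

theorem lam_le {a x : M} (ha : IsIdem a) (hx : x ≤ a) : lam a x ≤ a :=
  (EMVAlgebra.lam_isLeast a x ha ⟨zero_le_of x, hx⟩).1.1.2

theorem lam_add {a x : M} (ha : IsIdem a) (hx : x ≤ a) : lam a x + x = a :=
  (EMVAlgebra.lam_isLeast a x ha ⟨zero_le_of x, hx⟩).1.2

theorem lam_lam {a x : M} (ha : IsIdem a) (hx : x ≤ a) : lam a (lam a x) = x :=
  (EMVAlgebra.isMV a ha).star_star x ⟨zero_le_of x, hx⟩

theorem lam_le_iff {a x z : M} (ha : IsIdem a) (hx : x ≤ a) (hz : z ≤ a) :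
    lam a x ≤ z ↔ z + x = a := by
  refine ⟨fun h => le_antisymm (ha.add_le hz hx) ?_, fun h => ?_⟩
  · rw [← lam_add ha hx]
    exact add_le_add_left h x
  · exact (EMVAlgebra.lam_isLeast a x ha ⟨zero_le_of x, hx⟩).2 ⟨⟨zero_le_of z, hz⟩, h⟩

theorem le_iff_add_lam {a x z : M} (ha : IsIdem a) (hx : x ≤ a) (hz : z ≤ a) :
    x ≤ z ↔ z + lam a x = a := by
  rw [← lam_le_iff ha (lam_le ha hx) hz, lam_lam ha hx]

theorem lam_lam_add_le_iff {a x y z : M} (ha : IsIdem a) (hx : x ≤ a) (hy : y ≤ a)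
    (hz : z ≤ a) : lam a (lam a x + y) ≤ z ↔ x ≤ z + y := by
  rw [lam_le_iff ha (ha.add_le (lam_le ha hx) hy) hz,
    le_iff_add_lam ha hx (ha.add_le hz hy), add_comm (lam a x) y, add_assoc]

/-- Translation by `x` has a lower adjoint on `[0, a]`, so it preserves meets. -/
theorem add_inf_add_le (x y z : M) : (y + x) ⊓ (z + x) ≤ (y ⊓ z) + x := by
  obtain ⟨a, ha, hx, hy, hz⟩ := exists_idem_ge₃ x y z
  have hw : (y + x) ⊓ (z + x) ≤ a := inf_le_left.trans (ha.add_le hy hx)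
  rw [← lam_lam_add_le_iff ha hw hx (inf_le_left.trans hy)]
  exact le_inf ((lam_lam_add_le_iff ha hw hx hy).2 inf_le_left)
    ((lam_lam_add_le_iff ha hw hx hz).2 inf_le_right)

theorem inf_add_eq (x y z : M) : (y ⊓ z) + x = (y + x) ⊓ (z + x) :=
  le_antisymm (le_inf (add_le_add_left inf_le_left x) (add_le_add_left inf_le_right x))
    (add_inf_add_le x y z)

theorem add_inf_eq (x y z : M) : x + (y ⊓ z) = (x + y) ⊓ (x + z) := by
  simp only [add_comm x, inf_add_eq]

theorem lam_lam_add_le_iff' {a x y : M} (ha : IsIdem a) (hx : x ≤ a) (hy : y ≤ a) (z : M) :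
    lam a (lam a x + y) ≤ z ↔ x ≤ z + y := by
  have h := lam_lam_add_le_iff ha hx hy (z := z ⊓ a) inf_le_right
  have hl := lam_le ha (ha.add_le (lam_le ha hx) hy)
  rw [le_inf_iff, and_iff_left hl, inf_add_eq, le_inf_iff, and_iff_left] at h
  · exact h
  · exact hx.trans (le_add_of_nonneg_right (zero_le_of y))

/-- The equivalence ranges over all `z` in `M` and determines `w`, so the choice of `a` is
immaterial. -/
theorem exists_sub (x y : M) : ∃ w : M, ∀ z, w ≤ z ↔ x ≤ z + y := by
  obtain ⟨a, ha, hx, hy⟩ := exists_idem_ge x y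
  exact ⟨_, lam_lam_add_le_iff' ha hx hy⟩

/-- The truncated difference `x ⊖ y`. -/
noncomputable instance hasSub : Sub M := ⟨fun x y => (exists_sub x y).choose⟩

instance orderedSub : OrderedSub M := ⟨fun x y z => (exists_sub x y).choose_spec z⟩

theorem sub_eq_lam {a x y : M} (ha : IsIdem a) (hx : x ≤ a) (hy : y ≤ a) :
    x - y = lam a (lam a x + y) :=
  eq_of_forall_ge_iff fun z => by rw [tsub_le_iff_right, lam_lam_add_le_iff' ha hx hy]

theorem lam_zero {a : M} (ha : IsIdem a) : lam a 0 = a := by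
  simpa using lam_add ha (zero_le_of a)

theorem lam_self {a : M} (ha : IsIdem a) : lam a a = 0 := by
  rw [← lam_lam ha (zero_le_of a), lam_zero ha]

theorem lam_eq_sub {a x : M} (ha : IsIdem a) (hx : x ≤ a) : lam a x = a - x := by
  rw [sub_eq_lam ha le_rfl hx, lam_self ha, zero_add]

theorem sub_add_of_le {x y : M} (h : y ≤ x) : x - y + y = x := by
  obtain ⟨a, ha, hx, hy⟩ := exists_idem_ge x y
  -- For `y ≤ x` the inner sum `x + lam a y` is `a`, so the Łukasiewicz identity collapses to `x` on
  -- the left.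
  have hL := (EMVAlgebra.isMV a ha).op_star _ ⟨zero_le_of _, hx⟩ _ ⟨zero_le_of _, hy⟩
  have h' : x + lam a y = a := (le_iff_add_lam ha hy hx).1 h
  simp only [h', lam_self ha, add_zero] at hL
  rw [sub_eq_lam ha hx hy, add_comm (lam a x), add_comm, ← hL]

instance canonicallyOrderedAdd : CanonicallyOrderedAdd M where
  exists_add_of_le {x y} h := ⟨y - x, by rw [add_comm, sub_add_of_le h]⟩
  le_add_self x y := le_add_of_nonneg_left (zero_le_of y)
  le_self_add x y := le_add_of_nonneg_right (zero_le_of y)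

instance isInvolutiveSub : IsInvolutiveSub M where
  sub_sub_of_le x y h := by
    obtain ⟨a, ha, hx, hy⟩ := exists_idem_ge x y
    have hl := lam_le ha hx
    -- The same identity for the complements of `x` and `y`, whose order is reversed.
    have hL := (EMVAlgebra.isMV a ha).op_star _ ⟨zero_le_of _, hl⟩ _
      ⟨zero_le_of _, lam_le ha hy⟩
    simp only [lam_lam ha hx, lam_lam ha hy] at hL
    have h' : lam a y + x = a := by rw [add_comm]; exact (le_iff_add_lam ha hy hx).1 h
    rw [h', lam_self ha, add_zero] at hL
    rw [sub_eq_lam ha hx (tsub_le_self.trans hx), sub_eq_lam ha hx hy, hL, lam_lam ha hy]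

theorem sub_inf_self (x y : M) : x - x ⊓ y = x - y :=
  eq_of_forall_ge_iff fun z => by
    rw [tsub_le_iff_right, tsub_le_iff_right, add_inf_eq, le_inf_iff, and_iff_right le_add_self]

theorem sub_sub_eq_inf (x y : M) : x - (x - y) = x ⊓ y := by
  conv_lhs => rw [← sub_inf_self x y]
  exact sub_sub_of_le inf_le_left

theorem sub_add_inf (x y : M) : x - y + x ⊓ y = x := by
  rw [← sub_inf_self, tsub_add_cancel_of_le inf_le_left]

theorem sub_add_eq_sup (x y : M) : x - y + y = x ⊔ y := by
  refine le_antisymm ?_ (sup_le le_tsub_add le_add_self)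
  calc x - y + y ≤ (x ⊔ y) - y + y := add_le_add_left (tsub_le_tsub_right le_sup_left y) y
    _ = x ⊔ y := tsub_add_cancel_of_le le_sup_right

/-- Adding the meet `m` of the two differences to `x ⊓ y` stays below both `x` and `y`, hence below
`x ⊓ y`; cancellation gives `m = 0`. -/
theorem sub_inf_sub (x y : M) : (x - y) ⊓ (y - x) = 0 := by
  have h1 : (x - y) ⊓ (y - x) ≤ x - x ⊓ y := by rw [sub_inf_self]; exact inf_le_left
  rw [← add_sub_cancel_of_le_sub inf_le_left h1, tsub_eq_zero_iff_le]
  refine le_inf (add_le_of_le_sub inf_le_left h1) ?_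
  refine add_le_of_le_sub inf_le_right ?_
  rw [inf_comm x y, sub_inf_self]
  exact inf_le_right

theorem IsIdem.sub_inf {b : M} (hb : IsIdem b) (x : M) : (x - b) ⊓ b = 0 := by
  have h : (x - b) ⊓ b ≤ (x ⊔ b) - b :=
    inf_le_left.trans (tsub_le_tsub_right le_sup_left b)
  rw [← add_sub_cancel_of_le_sub le_sup_right h, tsub_eq_zero_iff_le]
  exact hb.add_le inf_le_right le_rfl

theorem IsIdem.add_inf {u : M} (hu : IsIdem u) (x y : M) : (x + y) ⊓ u = x ⊓ u + y ⊓ u := by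
  rw [inf_add_eq, add_inf_eq, add_inf_eq, hu]
  refine le_antisymm ?_ ?_
  · exact le_inf (le_inf inf_le_left (inf_le_right.trans le_add_self))
      (le_inf (inf_le_right.trans le_self_add) inf_le_right)
  · exact le_inf (inf_le_left.trans inf_le_left) (inf_le_right.trans inf_le_right)

/-- The double of `a - b` is still disjoint from `b`, so subtracting `b` leaves it unchanged; but it
lies below `a`. -/
theorem IsIdem.sub {a b : M} (ha : IsIdem a) (hb : IsIdem b) : IsIdem (a - b) := by
  refine le_antisymm ?_ le_self_add
  have h : ((a - b) + (a - b)) ⊓ b = 0 := by rw [hb.add_inf, hb.sub_inf, add_zero]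
  rw [← sub_add_inf ((a - b) + (a - b)) b, h, add_zero]
  exact tsub_le_tsub_right (ha.add_le tsub_le_self tsub_le_self) b

theorem IsIdem.add_le_sup {v : M} (hv : IsIdem v) (u : M) : u + v ≤ u ⊔ v :=
  calc u + v = (u - v) + (u ⊓ v + v) := by rw [← add_assoc, sub_add_inf]
    _ ≤ (u - v) + (v + v) := add_le_add_right (add_le_add_left inf_le_right v) _
    _ = u ⊔ v := by rw [hv, sub_add_eq_sup]

theorem IsIdem.add {u v : M} (hu : IsIdem u) (hv : IsIdem v) : IsIdem (u + v) := by
  unfold IsIdem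
  rw [add_add_add_comm, hu, hv]

theorem IsIdem.nsmul_le {a x : M} (ha : IsIdem a) (hx : x ≤ a) (n : ℕ) : n • x ≤ a := by
  induction n with
  | zero => simp
  | succ n ih => rw [succ_nsmul]; exact ha.add_le ih hx

theorem odot_eq {a x y : M} (ha : IsIdem a) (hx : x ≤ a) (hy : y ≤ a) :
    odot x y = a - ((a - x) + (a - y)) := by
  -- Independence of the ambient idempotent: the two sides are `x - (b - y)` and `x - (a - y)`, and
  -- inside `a` the complements `b - y` and `a - y` agree.
  have key : ∀ {a b : M}, IsIdem a → a ≤ b → x ≤ a → y ≤ a →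
      b - ((b - x) + (b - y)) = a - ((a - x) + (a - y)) := by
    intro a b ha hab hx hy
    rw [tsub_add_eq_tsub_tsub, sub_sub_of_le (hx.trans hab), tsub_add_eq_tsub_tsub,
      sub_sub_of_le hx]
    refine le_antisymm (tsub_le_tsub_left (tsub_le_tsub_right hab y) x) ?_
    rw [tsub_le_iff_right]
    have h1 : (b - y) ⊓ a ≤ a - y := by
      have h : (b - y) ⊓ a ≤ b - y := inf_le_left
      rw [← add_sub_cancel_of_le_sub (hy.trans hab) h]
      exact tsub_le_tsub_right (ha.add_le inf_le_right hy) y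
    calc x ≤ (x - (b - y) + (b - y)) ⊓ a := le_inf le_tsub_add hx
      _ = (x - (b - y)) ⊓ a + (b - y) ⊓ a := ha.add_inf _ _
      _ ≤ x - (b - y) + (a - y) := add_le_add inf_le_left h1
  set b := (EMVAlgebra.exists_idem (x ⊔ y)).choose with hb
  obtain ⟨hbi, hle⟩ := (EMVAlgebra.exists_idem (x ⊔ y)).choose_spec
  rw [← hb] at hbi hle
  have hxb := le_sup_left.trans hle
  have hyb := le_sup_right.trans hle
  have h0 : odot x y = b - ((b - x) + (b - y)) := by
    simp only [odot]
    rw [← hb, lam_eq_sub hbi hxb, lam_eq_sub hbi hyb,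
      lam_eq_sub hbi (hbi.add_le tsub_le_self tsub_le_self)]
  obtain ⟨c, hc, hac, hbc⟩ := exists_idem_ge a b
  rw [h0, ← key hbi hbc hxb hyb, key ha hac hx hy]

theorem powSucc_eq {a x : M} (ha : IsIdem a) (hx : x ≤ a) (n : ℕ) :
    powSucc x n = a - (n + 1) • (a - x) := by
  induction n with
  | zero => simp [powSucc, sub_sub_of_le hx]
  | succ n ih =>
    rw [powSucc, ih, odot_eq ha tsub_le_self hx,
      sub_sub_of_le (ha.nsmul_le tsub_le_self (n + 1)), ← succ_nsmul]

/-- Each `f i` splits as `(f i - c) + f i ⊓ c`, which is at most `(s - c) + v`; residuation then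
bounds `s - (s - c) = s ⊓ c`. -/
theorem inf_le_of_isLUB {ι : Type*} {f : ι → M} {s c v : M} (hs : IsLUB (Set.range f) s)
    (h : ∀ i, f i ⊓ c ≤ v) : s ⊓ c ≤ v := by
  have h1 : s ≤ v + (s - c) := by
    refine hs.2 (Set.forall_mem_range.2 fun i => ?_)
    rw [add_comm]
    calc f i = f i - c + f i ⊓ c := (sub_add_inf _ _).symm
      _ ≤ s - c + v := add_le_add (tsub_le_tsub_right (hs.1 ⟨i, rfl⟩) c) (h i)
  rw [← sub_sub_eq_inf]
  exact tsub_le_iff_right.2 h1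

theorem add_le_of_isLUB {ι : Type*} [Nonempty ι] {f : ι → M} {s w : M} (x : M)
    (hs : IsLUB (Set.range f) s) (h : ∀ i, x + f i ≤ w) : x + s ≤ w := by
  have hxw : x ≤ w := le_self_add.trans (h (Classical.arbitrary ι))
  obtain ⟨a, ha, hx, hsa⟩ := exists_idem_ge x s
  -- Truncating `s` at `a - x` does not change `x + s` and makes cancellation of `x` legitimate,
  -- which reduces the claim to meets.
  have h1 : s ⊓ (a - x) ≤ w - x := by
    refine inf_le_of_isLUB hs fun i => ?_
    have h2 : f i ⊓ (a - x) ≤ a - x := inf_le_right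
    rw [← add_sub_cancel_of_le_sub hx h2]
    refine tsub_le_tsub_right (le_trans ?_ (h i)) x
    rw [add_comm]
    exact add_le_add_right inf_le_left x
  calc x + s ≤ x + s ⊓ (a - x) := by
        rw [add_inf_eq]
        refine le_inf le_rfl ?_
        rw [add_tsub_cancel_of_le hx]
        exact ha.add_le hx hsa
    _ ≤ x + (w - x) := add_le_add_right h1 x
    _ = w := add_tsub_cancel_of_le hxw

theorem add_le_of_isLUB₂ {ι κ : Type*} [Nonempty ι] [Nonempty κ] {f : ι → M} {g : κ → M}
    {s t w : M} (hs : IsLUB (Set.range f) s) (ht : IsLUB (Set.range g) t)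
    (h : ∀ i j, f i + g j ≤ w) : s + t ≤ w := by
  refine add_le_of_isLUB s ht fun j => ?_
  rw [add_comm]
  refine add_le_of_isLUB (g j) hs fun i => ?_
  rw [add_comm]
  exact h i j

end Basic

/-! ### Idempotent hulls and kernels -/

section SigmaComplete

variable {M : Type*} [EMVAlgebra M] (hM : IsSigmaComplete M)

/-- The least idempotent above `x`, obtained as the supremum of the multiples of `x`. -/
noncomputable def idemHull (x : M) : M := (hM fun n => n • x).choose

theorem isLUB_idemHull (x : M) : IsLUB (Set.range fun n : ℕ => n • x) (idemHull hM x) :=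
  (hM fun n => n • x).choose_spec

theorem nsmul_le_idemHull (x : M) (n : ℕ) : n • x ≤ idemHull hM x :=
  (isLUB_idemHull hM x).1 ⟨n, rfl⟩

theorem le_idemHull (x : M) : x ≤ idemHull hM x := by
  simpa using nsmul_le_idemHull hM x 1

theorem idemHull_le {x a : M} (ha : IsIdem a) (hx : x ≤ a) : idemHull hM x ≤ a :=
  (isLUB_idemHull hM x).2 (Set.forall_mem_range.2 fun n => ha.nsmul_le hx n)

theorem isIdem_idemHull (x : M) : IsIdem (idemHull hM x) := by
  refine le_antisymm ?_ le_self_add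
  refine add_le_of_isLUB₂ (isLUB_idemHull hM x) (isLUB_idemHull hM x) fun m n => ?_
  rw [← add_nsmul]
  exact nsmul_le_idemHull hM x (m + n)

theorem idemHull_mono {x y : M} (h : x ≤ y) : idemHull hM x ≤ idemHull hM y :=
  idemHull_le hM (isIdem_idemHull hM y) (h.trans (le_idemHull hM y))

theorem isGLB_idemHull (x : M) : IsGLB {a : M | IsIdem a ∧ x ≤ a} (idemHull hM x) :=
  ⟨fun _ ha => idemHull_le hM ha.1 ha.2,
    fun _ hw => hw ⟨isIdem_idemHull hM x, le_idemHull hM x⟩⟩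

theorem idemHull_of_isIdem {a : M} (ha : IsIdem a) : idemHull hM a = a :=
  le_antisymm (idemHull_le hM ha le_rfl) (le_idemHull hM a)

/-- Disjointness passes to multiples because translations preserve meets, and then to suprema in
each variable. -/
theorem idemHull_inf_eq_zero {x y : M} (h : x ⊓ y = 0) :
    idemHull hM x ⊓ idemHull hM y = 0 := by
  have key : ∀ {x y : M}, x ⊓ y = 0 → ∀ n : ℕ, (n • x) ⊓ y = 0 := by
    intro x y h n
    induction n with
    | zero => simp
    | succ n ih =>
      refine le_antisymm ?_ (zero_le_of _)
      calc (n + 1) • x ⊓ y ≤ (n • x + x) ⊓ (n • x + y) ⊓ y := by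
            rw [succ_nsmul]
            exact le_inf (le_inf inf_le_left (inf_le_right.trans le_add_self)) inf_le_right
        _ = 0 := by rw [← add_inf_eq, h, add_zero, ih]
  refine le_antisymm (inf_le_of_isLUB (isLUB_idemHull hM x) fun n => ?_) (zero_le_of _)
  rw [inf_comm]
  refine inf_le_of_isLUB (isLUB_idemHull hM y) fun m => le_of_eq ?_
  rw [inf_comm, ← key (x := x) (y := m • y) _ n]
  rw [inf_comm, key (by rw [inf_comm, h])]

theorem isLUB_idemHull_of_isLUB {x : M} {xs : ℕ → M} (h : IsLUB (Set.range xs) x) :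
    IsLUB (Set.range fun n => idemHull hM (xs n)) (idemHull hM x) := by
  obtain ⟨e, he⟩ := hM fun n => idemHull hM (xs n)
  have hle : ∀ n, idemHull hM (xs n) ≤ e := fun n => he.1 ⟨n, rfl⟩
  have hei : IsIdem e := by
    refine le_antisymm (add_le_of_isLUB₂ he he fun m n => ?_) le_self_add
    exact ((isIdem_idemHull hM (xs n)).add_le_sup _).trans (sup_le (hle m) (hle n))
  have hxe : idemHull hM x ≤ e :=
    idemHull_le hM hei (h.2 (Set.forall_mem_range.2 fun n => (le_idemHull hM _).trans (hle n)))
  refine ⟨Set.forall_mem_range.2 fun n => idemHull_mono hM (h.1 ⟨n, rfl⟩), fun w hw => ?_⟩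
  exact hxe.trans (he.2 hw)

/-- If all multiples of `y` lie below the complement of `y`, then `y = 0`. -/
theorem eq_zero_of_nsmul_le_sub (hM : IsSigmaComplete M) {a y : M} (hy : y ≤ a) (h : ∀ n : ℕ, n • y ≤ a - y) :
    y = 0 := by
  have h1 : idemHull hM y ≤ a - y :=
    (isLUB_idemHull hM y).2 (Set.forall_mem_range.2 fun n => h n)
  have h2 : y ≤ a - idemHull hM y := le_sub_comm_of_le hy h1
  rw [← add_sub_cancel_of_le_sub (h1.trans tsub_le_self) h2, tsub_eq_zero_iff_le]
  exact (isIdem_idemHull hM y).add_le (le_idemHull hM y) le_rfl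

theorem exists_idemKernel (hM : IsSigmaComplete M) (x : M) : ∃ b : M,
    IsGLB (Set.range fun n : ℕ => powSucc x n) b ∧ IsIdem b ∧ b ≤ x ∧
      IsLUB {c : M | IsIdem c ∧ c ≤ x} b := by
  obtain ⟨a, ha, hx⟩ := EMVAlgebra.exists_idem x
  have hle : idemHull hM (a - x) ≤ a := idemHull_le hM ha tsub_le_self
  have hbx : a - idemHull hM (a - x) ≤ x := by
    conv_rhs => rw [← sub_sub_of_le hx]
    exact tsub_le_tsub_left (le_idemHull hM _) a
  have hi : IsIdem (a - idemHull hM (a - x)) := ha.sub (isIdem_idemHull hM _)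
  refine ⟨a - idemHull hM (a - x), ⟨?_, fun w hw => ?_⟩, hi, hbx, ?_, ?_⟩
  · refine Set.forall_mem_range.2 fun n => ?_
    rw [powSucc_eq ha hx]
    exact tsub_le_tsub_left (nsmul_le_idemHull hM _ _) a
  · have hwa : w ≤ a := (hw ⟨0, rfl⟩ : w ≤ x).trans hx
    refine le_sub_comm_of_le hwa ((isLUB_idemHull hM (a - x)).2
      (Set.forall_mem_range.2 fun n => ?_))
    -- `powSucc x n` is the power `n + 1`, so the bound obtained concerns `(n + 1) • (a - x)` and is
    -- weakened to `n • (a - x)`.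
    refine le_trans (nsmul_le_nsmul_left (zero_le_of _) n.le_succ)
      (le_sub_comm_of_le (ha.nsmul_le tsub_le_self _) ?_)
    rw [← powSucc_eq ha hx]
    exact hw ⟨n, rfl⟩
  · rintro c ⟨hc, hcx⟩
    exact le_sub_comm_of_le (hcx.trans hx)
      (idemHull_le hM (ha.sub hc) (tsub_le_tsub_left hcx a))
  · exact fun w hw => hw ⟨hi, hbx⟩

end SigmaComplete

/-! ### Mapping a chain to the unit interval -/

/-- `C` is a chain with largest element `e`. The type `Carry e` consists of the pairs
`(k, r)`, thought of as the element `k e + r` of the ordered group generated by `C`. -/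
@[ext]
structure Carry {C : Type*} (e : C) where
  int : ℕ
  frac : C

section Chain

variable {C : Type*} [AddCommMonoid C] [LinearOrder C] [IsOrderedAddMonoid C]
  [CanonicallyOrderedAdd C] [Sub C] [OrderedSub C] [IsInvolutiveSub C] {e : C}

open Classical in
/-- Addition with carry. -/
noncomputable instance Carry.hasAdd : Add (Carry e) :=
  ⟨fun p q => if p.frac + q.frac = e then ⟨p.int + q.int + 1, p.frac - (e - q.frac)⟩
    else ⟨p.int + q.int, p.frac + q.frac⟩⟩

theorem Carry.add_of_eq {k l : ℕ} {r s : C} (h : r + s = e) :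
    (⟨k, r⟩ + ⟨l, s⟩ : Carry e) = ⟨k + l + 1, r - (e - s)⟩ := if_pos h

theorem Carry.add_of_ne {k l : ℕ} {r s : C} (h : r + s ≠ e) :
    (⟨k, r⟩ + ⟨l, s⟩ : Carry e) = ⟨k + l, r + s⟩ := if_neg h

/-- Here `r - (e - s)` is the product `r ⊙ s` of the chain, the fractional part left after a carry.
-/
theorem mul_comm_of_top (he : ∀ x : C, x ≤ e) (r s : C) : r - (e - s) = s - (e - r) := by
  rw [sub_eq_compl_sub (e - s) (he r), sub_sub_of_le (he s)]

theorem add_eq_top_iff (he : ∀ x : C, x ≤ e) {r s : C} : r + s = e ↔ e - s ≤ r := by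
  rw [tsub_le_iff_right]
  exact ⟨fun h => h.ge, fun h => le_antisymm (he _) h⟩

theorem Carry.add_comm' (he : ∀ x : C, x ≤ e) (p q : Carry e) : p + q = q + p := by
  obtain ⟨k, r⟩ := p
  obtain ⟨l, s⟩ := q
  by_cases h : r + s = e
  · rw [add_of_eq h, add_of_eq (by rwa [add_comm]), mul_comm_of_top he, add_comm k]
  · rw [add_of_ne h, add_of_ne (by rwa [add_comm]), add_comm r, add_comm k]

/-- When only the second pair carries, both bracketings carry exactly once, and `key` matches the
fractional parts. The mirror case follows by commutativity. -/
theorem Carry.add_assoc_of_ne_of_eq (he : ∀ x : C, x ≤ e) {k l m : ℕ} {r s u : C} (h : r + s ≠ e) (h' : s + u = e) :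
    ((⟨k, r⟩ + ⟨l, s⟩) + ⟨m, u⟩ : Carry e) = ⟨k, r⟩ + (⟨l, s⟩ + ⟨m, u⟩) := by
  have hu : e - u ≤ s := (add_eq_top_iff he).1 h'
  have hr : r ≤ e - s := (not_le.1 fun h1 => h ((add_eq_top_iff he).2 h1)).le
  have key : (r + s) - (e - u) = r + (s - (e - u)) := by
    have h1 : r + (s - (e - u)) ≤ e - (e - u) := by
      rw [← tsub_add_cancel_of_le hu, add_comm, tsub_add_eq_tsub_tsub] at hr
      refine le_trans (add_le_add_left hr _) (tsub_add_cancel_of_le ?_).le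
      exact tsub_le_tsub_right (he s) _
    rw [← add_sub_cancel_of_le_sub tsub_le_self h1, add_assoc, tsub_add_cancel_of_le hu]
  have h2 : r + s + u = e := le_antisymm (he _) (by rw [add_assoc, h']; exact le_add_self)
  have h3 : r + (s - (e - u)) ≠ e := fun h3 => h (le_antisymm (he _) (by
    rw [← h3, ← key]; exact tsub_le_self))
  rw [add_of_ne h, add_of_eq h', add_of_eq h2, add_of_ne h3, key]
  simp only [add_assoc]

theorem Carry.add_assoc' (he : ∀ x : C, x ≤ e) (p q w : Carry e) : p + q + w = p + (q + w) := by
  obtain ⟨k, r⟩ := p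
  obtain ⟨l, s⟩ := q
  obtain ⟨m, u⟩ := w
  by_cases h : r + s = e <;> by_cases h' : s + u = e
  · have hs : e - s ≤ r := (add_eq_top_iff he).1 h
    have hu : e - s ≤ u := (add_eq_top_iff he).1 (by rwa [add_comm])
    have key : r - (e - s) + u = r + (s - (e - u)) := by
      rw [mul_comm_of_top he s u]
      conv_lhs => rw [← tsub_add_cancel_of_le hu]
      rw [add_left_comm, add_comm, tsub_add_cancel_of_le hs, add_comm]
    have key2 : e - (s - (e - u)) = (e - s) + (e - u) := by
      conv_lhs => rw [← sub_sub_of_le (he s)]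
      rw [← tsub_add_eq_tsub_tsub]
      refine sub_sub_of_le (he _)
    rw [add_of_eq h, add_of_eq h']
    by_cases h2 : r - (e - s) + u = e
    · rw [add_of_eq h2, add_of_eq (key ▸ h2), key2, tsub_add_eq_tsub_tsub]
      congr 1
      omega
    · rw [add_of_ne h2, add_of_ne (key ▸ h2), key]
      congr 1
      omega
  · rw [add_comm' he _ ⟨m, u⟩, add_comm' he ⟨k, r⟩ ⟨l, s⟩, add_comm' he ⟨k, r⟩,
      add_comm' he ⟨l, s⟩ ⟨m, u⟩]
    exact (add_assoc_of_ne_of_eq he (by rwa [add_comm]) (by rwa [add_comm])).symm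
  · exact add_assoc_of_ne_of_eq he h h'
  · by_cases h2 : r + s + u = e
    · have hr : r ≤ e - s := (not_le.1 fun h1 => h ((add_eq_top_iff he).2 h1)).le
      have hu : s ≤ e - u := (not_le.1 fun h1 => h' ((add_eq_top_iff he).2 h1)).le
      have key : r + s - (e - u) = r - (e - (s + u)) := by
        conv_lhs => rw [← tsub_add_cancel_of_le hu]
        rw [add_comm (e - u - s) s, tsub_add_eq_tsub_tsub, add_sub_cancel_of_le_sub (he s) hr,
          ← tsub_add_eq_tsub_tsub, add_comm u s]
      rw [add_of_ne h, add_of_ne h', add_of_eq h2, add_of_eq (by rwa [← add_assoc]), key]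
      simp only [add_assoc]
    · rw [add_of_ne h, add_of_ne h', add_of_ne h2, add_of_ne (by rwa [← add_assoc])]
      simp only [add_assoc]

open Classical in
/-- The inclusion of the chain in the semigroup of integral and fractional parts. -/
noncomputable def toCarry (e x : C) : Carry e := if x = e then ⟨1, 0⟩ else ⟨0, x⟩

theorem toCarry_top : toCarry e e = ⟨1, 0⟩ := if_pos rfl

theorem toCarry_of_ne {x : C} (h : x ≠ e) : toCarry e x = ⟨0, x⟩ := if_neg h

/-- Without overflow, a sum reaching `e` has carry remainder `0`, which is how `toCarry` normalises
`e`. -/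
theorem toCarry_add (he : ∀ x : C, x ≤ e) (h0 : e ≠ 0) {x y : C} (h : x ≤ e - y) :
    toCarry e (x + y) = toCarry e x + toCarry e y := by
  have top : ∀ y : C, e ≤ e - y → toCarry e (e + y) = toCarry e e + toCarry e y := by
    intro y h
    have hy : y = 0 := by simpa using le_sub_comm_of_le (he y) h
    rw [hy, add_zero, toCarry_top, toCarry_of_ne h0.symm, Carry.add_of_ne]
    · simp
    · simpa using h0.symm
  by_cases hx : x = e
  · rw [hx]
    exact top y (hx ▸ h)
  by_cases hy : y = e
  · rw [hy, add_comm, Carry.add_comm' he]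
    exact top x (le_sub_comm_of_le le_rfl (hy ▸ h))
  rw [toCarry_of_ne hx, toCarry_of_ne hy]
  by_cases hxy : x + y = e
  · rw [Carry.add_of_eq hxy, hxy, toCarry_top, tsub_eq_zero_of_le h]
  · rw [Carry.add_of_ne hxy, toCarry_of_ne hxy]

/-- The element `(n + 1) x` of the semigroup of integral and fractional parts. -/
noncomputable def mulCarry (e x : C) : ℕ → Carry e
  | 0 => toCarry e x
  | n + 1 => mulCarry e x n + toCarry e x

theorem mulCarry_add (he : ∀ x : C, x ≤ e) (h0 : e ≠ 0) {x y : C} (h : x ≤ e - y) (n : ℕ) :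
    mulCarry e (x + y) n = mulCarry e x n + mulCarry e y n := by
  induction n with
  | zero => exact toCarry_add he h0 h
  | succ n ih =>
    -- The laws depend on `he`, so the structure is only available locally.
    let _ : AddCommSemigroup (Carry e) :=
      { add_assoc := Carry.add_assoc' he, add_comm := Carry.add_comm' he }
    rw [mulCarry, ih, toCarry_add he h0 h]
    exact add_add_add_comm _ _ _ _

theorem mulCarry_top (h0 : e ≠ 0) (n : ℕ) : mulCarry e e n = ⟨n + 1, 0⟩ := by
  induction n with
  | zero => exact toCarry_top
  | succ n ih =>
    rw [mulCarry, ih, toCarry_top, Carry.add_of_ne (by simpa using h0.symm), add_zero]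

theorem Carry.int_add (p q : Carry e) :
    p.int + q.int ≤ (p + q).int ∧ (p + q).int ≤ p.int + q.int + 1 := by
  obtain ⟨k, r⟩ := p
  obtain ⟨l, s⟩ := q
  by_cases h : r + s = e
  · simp [add_of_eq h]
  · simp [add_of_ne h]

/-- The approximation `⌊(n + 1) x / e⌋ / (n + 1)` of the position of `x` in `[0, e]`. -/
noncomputable def approx (e x : C) (n : ℕ) : ℝ := (mulCarry e x n).int / (n + 1)

theorem approx_add (he : ∀ x : C, x ≤ e) (h0 : e ≠ 0) {x y : C} (h : x ≤ e - y) (n : ℕ) :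
    approx e x n + approx e y n ≤ approx e (x + y) n ∧
      approx e (x + y) n ≤ approx e x n + approx e y n + 1 / (n + 1) := by
  have hn : (0 : ℝ) < n + 1 := by positivity
  obtain ⟨h1, h2⟩ := Carry.int_add (mulCarry e x n) (mulCarry e y n)
  rw [approx, approx, approx, mulCarry_add he h0 h, ← add_div, ← add_div,
    div_le_div_iff_of_pos_right hn, div_le_div_iff_of_pos_right hn]
  exact ⟨by exact_mod_cast h1, by exact_mod_cast h2⟩

theorem approx_top (h0 : e ≠ 0) (n : ℕ) : approx e e n = 1 := by
  have hn : (n + 1 : ℝ) ≠ 0 := by positivity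
  rw [approx, mulCarry_top h0]
  push_cast
  exact div_self hn

theorem approx_nonneg (x : C) (n : ℕ) : 0 ≤ approx e x n := by
  unfold approx
  positivity

theorem approx_mem (he : ∀ x : C, x ≤ e) (h0 : e ≠ 0) (x : C) (n : ℕ) :
    approx e x n ∈ Set.Icc (0 : ℝ) 1 := by
  refine ⟨approx_nonneg x n, ?_⟩
  have h := (approx_add he h0 (x := e - x) (y := x) le_rfl n).1
  rw [tsub_add_cancel_of_le (he x), approx_top h0] at h
  linarith [approx_nonneg (e := e) (e - x) n]

/-- An ultrafilter limit makes convergence of the approximations unnecessary; their additivity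
defect is at most `1 / (n + 1)` and vanishes in the limit. -/
theorem exists_additive_of_chain (he : ∀ x : C, x ≤ e) (h0 : e ≠ 0) :
    ∃ t : C → ℝ, (∀ x, 0 ≤ t x) ∧ t e = 1 ∧ ∀ x y, x ≤ e - y → t (x + y) = t x + t y := by
  let U : Ultrafilter ℕ := Filter.hyperfilter ℕ
  have hlim : ∀ x : C, ∃ l ∈ Set.Icc (0 : ℝ) 1, Filter.Tendsto (approx e x) U (nhds l) :=
    fun x => isCompact_Icc.ultrafilter_le_nhds (U.map (approx e x))
      (Filter.le_principal_iff.2 (Filter.mem_map.2 (Filter.Eventually.of_forall (approx_mem he h0 x))))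
  choose t ht htl using hlim
  have hz : Filter.Tendsto (fun n : ℕ => (1 : ℝ) / (n + 1)) U (nhds 0) :=
    tendsto_one_div_add_atTop_nhds_zero_nat.mono_left Nat.hyperfilter_le_atTop
  refine ⟨t, fun x => (ht x).1, ?_, fun x y h => ?_⟩
  · refine tendsto_nhds_unique (htl e) ?_
    rw [funext (approx_top h0)]
    exact tendsto_const_nhds
  · refine le_antisymm ?_ ?_
    · have := ((htl x).add (htl y)).add hz
      rw [add_zero] at this
      exact le_of_tendsto_of_tendsto' (htl _) this fun n => (approx_add he h0 h n).2
    · exact le_of_tendsto_of_tendsto' ((htl x).add (htl y)) (htl _)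
        fun n => (approx_add he h0 h n).1

/-- A nontrivial chain with involutive complement has a morphism to the unit interval. -/
theorem exists_unit_of_chain (he : ∀ x : C, x ≤ e) (h0 : e ≠ 0) :
    ∃ t : C → ℝ, (∀ x, t x ∈ Set.Icc (0 : ℝ) 1) ∧ (∀ x, t (e - x) = 1 - t x) ∧ Monotone t ∧
      t 0 = 0 ∧ ∀ x y, t (x + y) = min 1 (t x + t y) := by
  obtain ⟨t, ht0, hte, hadd⟩ := exists_additive_of_chain he h0
  have hc : ∀ x, t (e - x) = 1 - t x := by
    intro x
    have h := hadd (e - x) x le_rfl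
    rw [tsub_add_cancel_of_le (he x), hte] at h
    linarith
  have hm : Monotone t := by
    intro x y hxy
    have h := hadd (y - x) x (tsub_le_tsub_right (he y) x)
    rw [tsub_add_cancel_of_le hxy] at h
    linarith [ht0 (y - x)]
  have h1 : ∀ x, t x ≤ 1 := fun x => hte ▸ hm (he x)
  refine ⟨t, fun x => ⟨ht0 x, h1 x⟩, hc, hm, ?_, fun x y => ?_⟩
  · have h := hadd 0 0 zero_le
    rw [add_zero] at h
    linarith
  · rcases le_total x (e - y) with h | h
    · rw [← hadd x y h, min_eq_right (h1 _)]
    · rw [(add_eq_top_iff he).2 h, hte, min_eq_left]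
      have := hm h
      rw [hc] at this
      linarith

end Chain

/-! ### Quotient chains and their state-morphisms -/

/-- An ideal whose quotient is a chain. -/
structure TotalIdeal (M : Type*) [EMVAlgebra M] where
  carrier : Set M
  zero_mem : 0 ∈ carrier
  add_mem : ∀ {x y}, x ∈ carrier → y ∈ carrier → x + y ∈ carrier
  mem_of_le : ∀ {x y}, x ≤ y → y ∈ carrier → x ∈ carrier
  total : ∀ x y, x - y ∈ carrier ∨ y - x ∈ carrier

namespace TotalIdeal

variable {M : Type*} [EMVAlgebra M] (P : TotalIdeal M)

theorem sub_mem_trans {x y z : M} (h : x - y ∈ P.carrier) (h' : y - z ∈ P.carrier) :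
    x - z ∈ P.carrier :=
  P.mem_of_le tsub_le_tsub_add_tsub (P.add_mem h h')

theorem add_sub_add_mem {w x y z : M} (h : w - x ∈ P.carrier) (h' : y - z ∈ P.carrier) :
    (w + y) - (x + z) ∈ P.carrier := by
  refine P.mem_of_le ?_ (P.add_mem h h')
  rw [tsub_le_iff_right, add_add_add_comm]
  exact add_le_add le_tsub_add le_tsub_add

theorem sub_sub_sub_mem {w x y z : M} (h : w - x ∈ P.carrier) (h' : z - y ∈ P.carrier) :
    (w - y) - (x - z) ∈ P.carrier := by
  refine P.mem_of_le ?_ (P.add_mem h h')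
  rw [tsub_le_iff_right, tsub_le_iff_right]
  calc w ≤ (w - x) + x := le_tsub_add
    _ ≤ (w - x) + ((x - z) + ((z - y) + y)) :=
        add_le_add_right (le_tsub_add.trans (add_le_add_right le_tsub_add _)) _
    _ = (w - x) + (z - y) + (x - z) + y := by
        rw [add_left_comm (x - z), ← add_assoc, ← add_assoc]

/-- The congruence defined by an ideal. -/
def con : AddCon M where
  r x y := x - y ∈ P.carrier ∧ y - x ∈ P.carrier
  iseqv :=
    { refl := fun x => by simp [P.zero_mem]
      symm := fun h => ⟨h.2, h.1⟩
      trans := fun h h' => ⟨P.sub_mem_trans h.1 h'.1, P.sub_mem_trans h'.2 h.2⟩ }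
  add' h h' := ⟨P.add_sub_add_mem h.1 h'.1, P.add_sub_add_mem h.2 h'.2⟩

/-- The quotient chain. -/
abbrev Chain : Type _ := P.con.Quotient

/-- The class of an element in the quotient chain. -/
def cls (x : M) : P.Chain := (x : P.con.Quotient)

theorem cls_surjective : Function.Surjective P.cls := Quotient.exists_rep

theorem cls_eq {x y : M} : P.cls x = P.cls y ↔ x - y ∈ P.carrier ∧ y - x ∈ P.carrier :=
  P.con.eq

theorem cls_add (x y : M) : P.cls (x + y) = P.cls x + P.cls y := rfl

theorem cls_zero : P.cls 0 = 0 := rfl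

instance : LE P.Chain :=
  ⟨fun a b => ∃ x y, P.cls x = a ∧ P.cls y = b ∧ x - y ∈ P.carrier⟩

theorem cls_le {x y : M} : P.cls x ≤ P.cls y ↔ x - y ∈ P.carrier := by
  refine ⟨?_, fun h => ⟨x, y, rfl, rfl, h⟩⟩
  rintro ⟨x', y', hx, hy, h⟩
  exact P.sub_mem_trans ((P.cls_eq.1 hx).2) (P.sub_mem_trans h (P.cls_eq.1 hy).1)

open Classical in
noncomputable instance : LinearOrder P.Chain where
  le_refl a := by
    obtain ⟨x, rfl⟩ := P.cls_surjective a
    simp [cls_le, P.zero_mem]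
  le_trans a b c := by
    obtain ⟨x, rfl⟩ := P.cls_surjective a
    obtain ⟨y, rfl⟩ := P.cls_surjective b
    obtain ⟨z, rfl⟩ := P.cls_surjective c
    simp only [cls_le]
    exact P.sub_mem_trans
  le_antisymm a b := by
    obtain ⟨x, rfl⟩ := P.cls_surjective a
    obtain ⟨y, rfl⟩ := P.cls_surjective b
    simp only [cls_le, cls_eq]
    exact And.intro
  le_total a b := by
    obtain ⟨x, rfl⟩ := P.cls_surjective a
    obtain ⟨y, rfl⟩ := P.cls_surjective b
    simp only [cls_le]
    exact P.total x y
  toDecidableLE := Classical.decRel _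

theorem cls_mono : Monotone P.cls := fun x y h => by
  rw [cls_le, tsub_eq_zero_of_le h]
  exact P.zero_mem

noncomputable instance : Sub P.Chain :=
  ⟨Quotient.map₂ (· - ·) fun _ _ h _ _ h' =>
    ⟨P.sub_sub_sub_mem h.1 h'.2, P.sub_sub_sub_mem h.2 h'.1⟩⟩

theorem cls_sub (x y : M) : P.cls (x - y) = P.cls x - P.cls y := rfl

instance : IsOrderedAddMonoid P.Chain where
  add_le_add_left a b h c := by
    obtain ⟨x, rfl⟩ := P.cls_surjective a
    obtain ⟨y, rfl⟩ := P.cls_surjective b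
    obtain ⟨z, rfl⟩ := P.cls_surjective c
    rw [← cls_add, ← cls_add, cls_le]
    exact P.add_sub_add_mem (P.cls_le.1 h) (by simp [P.zero_mem])

instance : OrderedSub P.Chain where
  tsub_le_iff_right a b c := by
    obtain ⟨x, rfl⟩ := P.cls_surjective a
    obtain ⟨y, rfl⟩ := P.cls_surjective b
    obtain ⟨z, rfl⟩ := P.cls_surjective c
    rw [← cls_add, ← cls_sub, cls_le, cls_le, ← tsub_add_eq_tsub_tsub, add_comm y z]

theorem cls_sup_of_le {x y : M} (h : P.cls x ≤ P.cls y) : P.cls (x ⊔ y) = P.cls y := by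
  refine le_antisymm (P.cls_le.2 (P.mem_of_le ?_ (P.cls_le.1 h))) (P.cls_mono le_sup_right)
  rw [tsub_le_iff_right, sub_add_eq_sup]

theorem cls_sup (x y : M) : P.cls (x ⊔ y) = P.cls x ⊔ P.cls y := by
  rcases le_total (P.cls x) (P.cls y) with h | h
  · rw [P.cls_sup_of_le h, sup_eq_right.2 h]
  · rw [sup_comm, P.cls_sup_of_le h, sup_eq_left.2 h]

theorem cls_inf_of_le {x y : M} (h : P.cls x ≤ P.cls y) : P.cls (x ⊓ y) = P.cls x := by
  refine le_antisymm (P.cls_mono inf_le_left) (P.cls_le.2 ?_)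
  rw [sub_inf_self]
  exact P.cls_le.1 h

theorem cls_inf (x y : M) : P.cls (x ⊓ y) = P.cls x ⊓ P.cls y := by
  rcases le_total (P.cls x) (P.cls y) with h | h
  · rw [P.cls_inf_of_le h, inf_eq_left.2 h]
  · rw [inf_comm, P.cls_inf_of_le h, inf_eq_right.2 h]

instance : CanonicallyOrderedAdd P.Chain where
  exists_add_of_le {a b} h := by
    obtain ⟨x, rfl⟩ := P.cls_surjective a
    obtain ⟨y, rfl⟩ := P.cls_surjective b
    refine ⟨P.cls (y - x), ?_⟩
    rw [← cls_add, add_comm, sub_add_eq_sup, cls_sup, sup_eq_left.2 h]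
  le_add_self a b := by
    obtain ⟨x, rfl⟩ := P.cls_surjective a
    obtain ⟨y, rfl⟩ := P.cls_surjective b
    exact P.cls_mono le_add_self
  le_self_add a b := by
    obtain ⟨x, rfl⟩ := P.cls_surjective a
    obtain ⟨y, rfl⟩ := P.cls_surjective b
    exact P.cls_mono le_self_add

instance : IsInvolutiveSub P.Chain where
  sub_sub_of_le a b h := by
    obtain ⟨x, rfl⟩ := P.cls_surjective a
    obtain ⟨y, rfl⟩ := P.cls_surjective b
    rw [← cls_sub, ← cls_sub, sub_sub_eq_inf, cls_inf, inf_eq_right.2 h]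

theorem cls_eq_top_of_isIdem {b : M} (hb : IsIdem b) (hbP : b ∉ P.carrier)
    (hprime : ∀ x y, x ⊓ y = 0 → x ∈ P.carrier ∨ y ∈ P.carrier) (c : P.Chain) :
    c ≤ P.cls b := by
  obtain ⟨x, rfl⟩ := P.cls_surjective c
  exact P.cls_le.2 ((hprime _ _ (hb.sub_inf x)).resolve_right hbP)

/-- The quotient chain of an ideal that contains one of any two disjoint elements yields a
state-morphism. -/
theorem exists_stateMorphism {a : M} (ha : IsIdem a) (haP : a ∉ P.carrier)
    (hprime : ∀ x y, x ⊓ y = 0 → x ∈ P.carrier ∨ y ∈ P.carrier) :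
    ∃ s : StateMorphism M, ∀ (n : ℕ) (y : M), (a - y) - n • y ∈ P.carrier → 0 < s.toFun y := by
  have ne0 : ∀ {b : M}, b ∉ P.carrier → P.cls b ≠ 0 := by
    intro b hb h
    rw [← cls_zero, cls_eq, tsub_zero] at h
    exact hb h.1
  have htop := P.cls_eq_top_of_isIdem ha haP hprime
  obtain ⟨t, htI, htc, htm, ht0, htadd⟩ := exists_unit_of_chain htop (ne0 haP)
  have ht1 : t (P.cls a) = 1 := by simpa [ht0] using htc 0
  have hlam : ∀ b, IsIdem b → ∀ x ≤ b, t (P.cls (b - x)) = t (P.cls b) - t (P.cls x) := by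
    intro b hb x hx
    -- An idempotent is either in the ideal, together with everything below it, or has the same
    -- class as `a`, the top.
    by_cases hbP : b ∈ P.carrier
    · have hz : ∀ y, y ≤ b → t (P.cls y) = 0 := by
        intro y hy
        rw [← ht0, ← cls_zero, P.cls_eq.2]
        simpa [P.zero_mem] using P.mem_of_le hy hbP
      rw [hz _ tsub_le_self, hz _ le_rfl, hz _ hx, sub_zero]
    · have h : P.cls b = P.cls a :=
        le_antisymm (htop _) (P.cls_eq_top_of_isIdem hb hbP hprime _)
      rw [cls_sub, h, htc, ht1]
  have hsmul : ∀ (n : ℕ) (y : M), t (P.cls (n • y)) ≤ n * t (P.cls y) := by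
    intro n y
    induction n with
    | zero => simp [cls_zero, ht0]
    | succ n ih =>
      rw [succ_nsmul, cls_add, htadd]
      refine (min_le_right _ _).trans ?_
      push_cast
      linarith
  refine ⟨⟨⟨fun x => ⟨t (P.cls x), htI _⟩, fun x y => ?_, fun x y => ?_, fun x y => ?_, ?_,
    fun b hb x hx => ?_⟩, a, Subtype.ext ht1⟩, fun n y h => ?_⟩
  · apply Subtype.ext
    show t (P.cls (x ⊔ y)) = max (t (P.cls x)) (t (P.cls y))
    rw [cls_sup, htm.map_sup]
  · apply Subtype.ext
    show t (P.cls (x ⊓ y)) = min (t (P.cls x)) (t (P.cls y))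
    rw [cls_inf, htm.map_inf]
  · apply Subtype.ext
    rw [unit_coe_add]
    exact htadd (P.cls x) (P.cls y)
  · exact Subtype.ext ht0
  · apply Subtype.ext
    rw [(unit_isLeast (Subtype.coe_le_coe.1 (htm (P.cls_mono hx.2)))).2, lam_eq_sub hb hx.2]
    exact hlam b hb x hx.2
  · apply Subtype.coe_lt_coe.1
    show (0 : ℝ) < t (P.cls y)
    -- In the chain `a - y ≤ n • y`, so `1 - t ≤ n t` for the value `t` at `y`, which excludes `t =
    -- 0`.
    have h1 := (htm (P.cls_le.2 h)).trans (hsmul n y)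
    rw [cls_sub, htc] at h1
    by_contra h2
    have h3 : t (P.cls y) = 0 := le_antisymm (not_lt.1 h2) (htI _).1
    rw [h3] at h1
    norm_num at h1

end TotalIdeal

/-! ### Separation by state-morphisms -/

variable {M : Type*} [EMVAlgebra M]

/-- The ideal of the elements whose idempotent hull lies in a prime lattice ideal. -/
def hullIdeal (hM : IsSigmaComplete M) (J : Order.Ideal M) (hJ : J.IsPrime) : TotalIdeal M where
  carrier := {x | idemHull hM x ∈ J}
  zero_mem := by
    show idemHull hM (0 : M) ∈ J
    rw [idemHull_of_isIdem hM (add_zero 0)]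
    obtain ⟨z, hz⟩ := J.nonempty
    exact J.lower (zero_le_of z) hz
  add_mem {x y} hx hy := by
    refine J.lower ?_ (J.sup_mem hx hy)
    refine le_trans (idemHull_le hM ((isIdem_idemHull hM x).add (isIdem_idemHull hM y))
      (add_le_add (le_idemHull hM x) (le_idemHull hM y))) ?_
    exact (isIdem_idemHull hM y).add_le_sup _
  mem_of_le h hy := J.lower (idemHull_mono hM h) hy
  total x y := by
    refine hJ.mem_or_mem ?_
    rw [idemHull_inf_eq_zero hM (sub_inf_sub x y)]
    obtain ⟨z, hz⟩ := J.nonempty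
    exact J.lower (zero_le_of z) hz

/-- σ-completeness makes `M` Archimedean, so some `w = n • y - (a - y)` is nonzero. Keeping `w` out
of the ideal forces the disjoint element `(a - y) - n • y` into it, which bounds the value at `y`
away from `0`. -/
theorem exists_stateMorphism_pos (hM : IsSigmaComplete M) {y : M} (hy : y ≠ 0) :
    ∃ s : StateMorphism M, 0 < s.toFun y := by
  obtain ⟨a, ha, hya⟩ := EMVAlgebra.exists_idem y
  obtain ⟨n, hn⟩ : ∃ n : ℕ, ¬ n • y ≤ a - y := by
    by_contra! h
    exact hy (eq_zero_of_nsmul_le_sub hM hya h)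
  set w := n • y - (a - y) with hw
  have hw0 : w ≠ 0 := fun h => hn (tsub_eq_zero_iff_le.1 h)
  have hd : Disjoint (Order.PFilter.principal (idemHull hM w) : Set M)
      (Order.Ideal.principal (0 : M) : Set M) := by
    refine Set.disjoint_left.2 fun z hz hz0 => hw0 (le_antisymm ?_ (zero_le_of w))
    exact (le_idemHull hM w).trans (le_trans hz hz0)
  obtain ⟨J, hJ, h0J, hdJ⟩ := DistribLattice.prime_ideal_of_disjoint_filter_ideal hd
  have h0 : (0 : M) ∈ J := h0J Order.Ideal.mem_principal_self
  have hwJ : idemHull hM w ∉ J := fun h =>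
    Set.disjoint_left.1 hdJ (Order.PFilter.mem_principal.2 le_rfl) h
  have hprime : ∀ u v : M, u ⊓ v = 0 →
      u ∈ (hullIdeal hM J hJ).carrier ∨ v ∈ (hullIdeal hM J hJ).carrier := by
    intro u v huv
    refine hJ.mem_or_mem ?_
    rwa [idemHull_inf_eq_zero hM huv]
  have haP : a ∉ (hullIdeal hM J hJ).carrier := fun h =>
    hwJ (J.lower (idemHull_mono hM (tsub_le_self.trans (ha.nsmul_le hya n))) h)
  obtain ⟨s, hs⟩ := (hullIdeal hM J hJ).exists_stateMorphism ha haP hprime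
  exact ⟨s, hs n y ((hprime _ _ (sub_inf_sub _ _)).resolve_left hwJ)⟩

/-! ### The weak topology and closures of supports -/

section States

variable {M : Type*} [EMVAlgebra M]

theorem state_add (s : StateMorphism M) (x y : M) :
    (s.toFun (x + y) : ℝ) = min 1 ((s.toFun x : ℝ) + s.toFun y) := by
  rw [s.map_add, unit_coe_add]

theorem state_mono (s : StateMorphism M) : Monotone s.toFun := fun x y h => by
  rw [← sup_eq_right.2 h, s.map_sup]
  exact le_sup_left

theorem state_idem (s : StateMorphism M) {a : M} (ha : IsIdem a) :
    (s.toFun a : ℝ) = 0 ∨ (s.toFun a : ℝ) = 1 := by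
  apply unit_idem
  show s.toFun a + s.toFun a = s.toFun a
  rw [← s.map_add, ha]

theorem state_lam (s : StateMorphism M) {a x : M} (ha : IsIdem a) (hx : x ≤ a) :
    (s.toFun (a - x) : ℝ) = s.toFun a - s.toFun x := by
  rw [← lam_eq_sub ha hx, s.map_lam a ha x ⟨zero_le_of x, hx⟩,
    (unit_isLeast (state_mono s hx)).2]

theorem state_sub (s : StateMorphism M) (x y : M) :
    (s.toFun (x - y) : ℝ) = max 0 ((s.toFun x : ℝ) - s.toFun y) := by
  obtain ⟨a, ha, hx, hy⟩ := exists_idem_ge x y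
  have hxa : (s.toFun x : ℝ) ≤ s.toFun a := state_mono s hx
  have hya : (s.toFun y : ℝ) ≤ s.toFun a := state_mono s hy
  have hx0 := (s.toFun x).2.1
  have hy0 := (s.toFun y).2.1
  have h : x - y = a - ((a - x) + y) := by
    rw [tsub_add_eq_tsub_tsub, sub_sub_of_le hx]
  rw [h, state_lam s ha (ha.add_le tsub_le_self hy), state_add, state_lam s ha hx]
  rcases state_idem s ha with h0 | h0 <;> rw [h0] at hxa hya ⊢ <;> grind

/-- The elements representing the functions `t ↦ max 0 (min 1 (n t - k))`. -/
theorem exists_clip (y : M) (n : ℕ) : ∀ k : ℕ, ∃ z : M, ∀ s : StateMorphism M,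
    (s.toFun z : ℝ) = max 0 (min 1 (n * (s.toFun y : ℝ) - k)) := by
  obtain ⟨a, ha, hy⟩ := EMVAlgebra.exists_idem y
  induction n with
  | zero =>
    refine fun k => ⟨0, fun s => ?_⟩
    have hk : (0 : ℝ) ≤ k := k.cast_nonneg
    rw [s.map_zero]
    simp only [Nat.cast_zero, zero_mul, zero_sub]
    rw [max_eq_left ((min_le_right _ _).trans (by linarith))]
    rfl
  | succ n ih =>
    intro k
    cases k with
    | zero =>
      obtain ⟨z, hz⟩ := ih 0
      refine ⟨z + y, fun s => ?_⟩
      rw [state_add, hz]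
      have := (s.toFun y).2.1
      have : (0 : ℝ) ≤ n * (s.toFun y : ℝ) := by positivity
      push_cast
      grind
    | succ k =>
      obtain ⟨z, hz⟩ := ih (k + 1)
      obtain ⟨w, hw⟩ := ih k
      -- With `t` the value at `y` and `s a = 1`: if `n t - k ≤ 1` then `z` contributes `0` and `w -
      -- (1 - t)` is the answer; otherwise `w` is `1` and `t` is added to `z`.
      refine ⟨z + (w - (a - y)), fun s => ?_⟩
      rw [state_add, state_sub, state_lam s ha hy, hz, hw]
      have hy0 := (s.toFun y).2.1
      have hy1 := (s.toFun y).2.2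
      have hya : (s.toFun y : ℝ) ≤ s.toFun a := state_mono s hy
      push_cast
      rcases state_idem s ha with h0 | h0
      · rw [h0] at hya ⊢
        have hk : (0 : ℝ) ≤ k := k.cast_nonneg
        have h1 : (s.toFun y : ℝ) = 0 := le_antisymm hya hy0
        rw [h1]
        grind
      · rw [h0]
        generalize (s.toFun y : ℝ) = y at *
        grind

theorem exists_pos_imp_lt (y : M) (s : StateMorphism M) {r : ℝ} (h0 : 0 ≤ r)
    (hr : r < s.toFun y) :
    ∃ z : M, 0 < s.toFun z ∧ ∀ t : StateMorphism M, 0 < t.toFun z → r < (t.toFun y : ℝ) := by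
  obtain ⟨q, hq1, hq2⟩ := exists_rat_btwn hr
  have hq0 : 0 ≤ q := by exact_mod_cast h0.trans hq1.le
  have hd : (0 : ℝ) < q.den := by exact_mod_cast q.den_pos
  have hq : (q.num.toNat : ℝ) = q * q.den := by
    have h1 : ((q.num.toNat : ℤ) : ℚ) = q * q.den := by
      rw [Int.toNat_of_nonneg (Rat.num_nonneg.2 hq0), Rat.mul_den_eq_num]
    exact_mod_cast h1
  -- Clipping `den * t - num` at `0` gives an element positive exactly where `y` exceeds `q = num /
  -- den`.
  obtain ⟨z, hz⟩ := exists_clip y q.den q.num.toNat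
  have key : ∀ t : StateMorphism M, 0 < t.toFun z ↔ (q : ℝ) < t.toFun y := by
    intro t
    rw [← Subtype.coe_lt_coe, hz, hq]
    show (0 : ℝ) < _ ↔ _
    rw [lt_max_iff, lt_min_iff]
    simp only [lt_irrefl, false_or, zero_lt_one, true_and, sub_pos]
    rw [mul_comm, mul_lt_mul_iff_right₀ hd]
  exact ⟨z, (key s).2 hq2, fun t ht => hq1.trans ((key t).1 ht)⟩

theorem exists_idem_state_eq_one (s : StateMorphism M) (y : M) :
    ∃ a : M, IsIdem a ∧ y ≤ a ∧ (s.toFun a : ℝ) = 1 := by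
  obtain ⟨x, hx⟩ := s.exists_eq_one
  obtain ⟨a, ha, hya, hxa⟩ := exists_idem_ge y x
  refine ⟨a, ha, hya, le_antisymm (s.toFun a).2.2 ?_⟩
  have h : (s.toFun x : ℝ) ≤ s.toFun a := state_mono s hxa
  rwa [hx] at h

theorem exists_pos_imp_gt (y : M) (s : StateMorphism M) {r : ℝ} (h1 : r ≤ 1)
    (hr : s.toFun y < r) :
    ∃ z : M, 0 < s.toFun z ∧ ∀ t : StateMorphism M, 0 < t.toFun z → (t.toFun y : ℝ) < r := by
  obtain ⟨a, ha, hy, hsa⟩ := exists_idem_state_eq_one s y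
  obtain ⟨z, hz, hzt⟩ := exists_pos_imp_lt (a - y) s (r := 1 - r) (by linarith)
    (by rw [state_lam s ha hy, hsa]; linarith)
  refine ⟨z, hz, fun t ht => ?_⟩
  have := hzt t ht
  rw [state_lam t ha hy] at this
  linarith [(t.toFun a).2.2]

/-- The sets `S(z)` form a base of the weak topology. -/
theorem exists_stateSupport_subset {s : StateMorphism M} {U : Set (StateMorphism M)}
    (hU : U ∈ nhds s) : ∃ z : M, s ∈ stateSupport z ∧ stateSupport z ⊆ U := by
  -- The filter generated by the sets `S(z)` containing `s`; they are closed under intersection as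
  -- `S(z) ∩ S(w) = S(z ⊓ w)`. Comparing it with `nhds s` can be done one coordinate at a time.
  let G : Filter (StateMorphism M) :=
    { sets := {V | ∃ z : M, s ∈ stateSupport z ∧ stateSupport z ⊆ V}
      univ_sets := by
        obtain ⟨x, hx⟩ := s.exists_eq_one
        refine ⟨x, ?_, Set.subset_univ _⟩
        show 0 < s.toFun x
        rw [hx]
        exact zero_lt_one
      sets_of_superset := fun ⟨z, hz, hzV⟩ h => ⟨z, hz, hzV.trans h⟩
      inter_sets := by
        rintro V W ⟨z, hz, hzV⟩ ⟨w, hw, hwW⟩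
        refine ⟨z ⊓ w, ?_, fun t ht => ?_⟩
        · show 0 < s.toFun (z ⊓ w)
          rw [s.map_inf]
          exact lt_inf_iff.2 ⟨hz, hw⟩
        · have h : 0 < t.toFun (z ⊓ w) := ht
          rw [t.map_inf] at h
          exact ⟨hzV (lt_inf_iff.1 h).1, hwW (lt_inf_iff.1 h).2⟩ }
  suffices h : G ≤ nhds s from h hU
  rw [nhds_induced, ← Filter.tendsto_iff_comap, tendsto_pi_nhds]
  intro y
  rw [tendsto_order]
  refine ⟨fun r hr => ?_, fun r hr => ?_⟩
  · obtain ⟨z, hz, h⟩ := exists_pos_imp_lt y s r.2.1 hr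
    exact ⟨z, hz, h⟩
  · obtain ⟨z, hz, h⟩ := exists_pos_imp_gt y s r.2.2 hr
    exact ⟨z, hz, h⟩

/-- State-morphisms take only the values `0` and `1` on idempotents, so positivity is the closed
condition `1 ≤ s a`. -/
theorem isClosed_stateSupport {a : M} (ha : IsIdem a) : IsClosed (stateSupport a) := by
  have h : stateSupport a = {s : StateMorphism M | 1 ≤ s.toFun a} := by
    ext s
    show 0 < s.toFun a ↔ 1 ≤ s.toFun a
    rw [← Subtype.coe_lt_coe, ← Subtype.coe_le_coe]
    show (0 : ℝ) < _ ↔ (1 : ℝ) ≤ _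
    rcases state_idem s ha with h | h <;> rw [h] <;> norm_num
  rw [h]
  exact isClosed_le continuous_const ((continuous_apply a).comp continuous_induced_dom)

theorem stateSupport_mono {x y : M} (h : x ≤ y) : stateSupport x ⊆ stateSupport y :=
  fun s hs => lt_of_lt_of_le hs (state_mono s h)

theorem closure_stateSupport (hM : IsSigmaComplete M) (x : M) :
    closure (stateSupport x) = stateSupport (idemHull hM x) := by
  refine (closure_minimal (stateSupport_mono (le_idemHull hM x))
    (isClosed_stateSupport (isIdem_idemHull hM x))).antisymm fun s hs => ?_
  by_contra hsc
  obtain ⟨z, hz, hzU⟩ := exists_stateSupport_subset (isClosed_closure.isOpen_compl.mem_nhds hsc)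
  have hzx : z ⊓ x = 0 := by
    by_contra h
    obtain ⟨t, ht⟩ := exists_stateMorphism_pos hM h
    rw [t.map_inf, lt_inf_iff] at ht
    exact hzU ht.1 (subset_closure ht.2)
  have h : z ⊓ idemHull hM x = 0 :=
    le_antisymm ((inf_le_inf_right _ (le_idemHull hM z)).trans
      (idemHull_inf_eq_zero hM hzx).le) (zero_le_of _)
  have hpos : 0 < s.toFun (z ⊓ idemHull hM x) := by
    rw [s.map_inf]
    exact lt_inf_iff.2 ⟨hz, hs⟩
  rw [h, s.map_zero] at hpos
  exact lt_irrefl _ hpos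

/-- A state-morphism positive on `a - b` is positive on `a`, hence equals `1` on `b`, which makes it
vanish on `a - b`. -/
theorem le_of_stateSupport_subset (hM : IsSigmaComplete M) {a b : M} (hb : IsIdem b)
    (h : stateSupport a ⊆ stateSupport b) : a ≤ b := by
  rw [← tsub_eq_zero_iff_le]
  by_contra hne
  obtain ⟨s, hs⟩ := exists_stateMorphism_pos hM hne
  have hsr : (0 : ℝ) < s.toFun (a - b) := hs
  have hsa : 0 < s.toFun a := lt_of_lt_of_le hs (state_mono s tsub_le_self)
  have hsb : (0 : ℝ) < s.toFun b := h hsa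
  have hb1 : (s.toFun b : ℝ) = 1 := (state_idem s hb).resolve_left hsb.ne'
  rw [state_sub, hb1, max_eq_left (by linarith [(s.toFun a).2.2])] at hsr
  exact lt_irrefl _ hsr

theorem idemHull_eq_of_closure_eq (hM : IsSigmaComplete M) {x b : M} (hb : IsIdem b)
    (h : closure (stateSupport x) = stateSupport b) : idemHull hM x = b := by
  rw [closure_stateSupport hM] at h
  exact le_antisymm (le_of_stateSupport_subset hM hb h.le)
    (le_of_stateSupport_subset hM (isIdem_idemHull hM x) h.ge)

end States

end EMV

theorem mainTheorem10 {M : Type*} [EMVAlgebra M] (hM : EMV.IsSigmaComplete M) :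
    ∃ a₀ b₀ : M → M,
      (∀ x : M,
        IsLUB (Set.range fun n : ℕ => n • x) (a₀ x) ∧
        EMV.IsIdem (a₀ x) ∧
        x ≤ a₀ x ∧
        IsGLB {a : M | EMV.IsIdem a ∧ x ≤ a} (a₀ x) ∧
        closure (EMV.stateSupport x) = EMV.stateSupport (a₀ x) ∧
        ∀ b : M, EMV.IsIdem b →
          closure (EMV.stateSupport x) = EMV.stateSupport b → a₀ x = b) ∧
      (∀ x : M,
        IsGLB (Set.range fun n : ℕ => EMV.powSucc x n) (b₀ x) ∧
        EMV.IsIdem (b₀ x) ∧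
        b₀ x ≤ x ∧
        IsLUB {b : M | EMV.IsIdem b ∧ b ≤ x} (b₀ x)) ∧
      (∀ x y b : M, x ≤ y → EMV.IsIdem b →
        closure (EMV.stateSupport y) = EMV.stateSupport b → a₀ x ≤ b) ∧
      (∀ (x : M) (xs : ℕ → M) (a : M) (as : ℕ → M),
        EMV.IsIdem a → (∀ n, EMV.IsIdem (as n)) →
        closure (EMV.stateSupport x) = EMV.stateSupport a →
        (∀ n, closure (EMV.stateSupport (xs n)) = EMV.stateSupport (as n)) →
        IsLUB (Set.range xs) x → IsLUB (Set.range as) a) ∧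
      (∀ (x : M) (xs : ℕ → M),
        IsLUB (Set.range xs) x → IsLUB (Set.range fun n => a₀ (xs n)) (a₀ x)) := by

  choose b₀ hb₀ using EMV.exists_idemKernel hM
  refine ⟨EMV.idemHull hM, b₀, fun x => ⟨EMV.isLUB_idemHull hM x, EMV.isIdem_idemHull hM x,
    EMV.le_idemHull hM x, EMV.isGLB_idemHull hM x, EMV.closure_stateSupport hM x,
    fun b hb h => EMV.idemHull_eq_of_closure_eq hM hb h⟩, hb₀, fun x y b hxy hb h => ?_,
    fun x xs a as ha has hx hxs h => ?_, fun x xs h => EMV.isLUB_idemHull_of_isLUB hM h⟩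
  -- By uniqueness, any idempotent representing a closure is the hull, so both remaining claims
  -- concern hulls only.
  · rw [← EMV.idemHull_eq_of_closure_eq hM hb h]
    exact EMV.idemHull_mono hM hxy
  · rw [← EMV.idemHull_eq_of_closure_eq hM ha hx,
      ← funext fun n => EMV.idemHull_eq_of_closure_eq hM (has n) (hxs n)]
    exact EMV.isLUB_idemHull_of_isLUB hM h
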